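/- For a positive integer $x$ let $\sigma(x)=\sum_{d\mid x} d$, and put $\sigma(x)=0$ for every rational number $x$ that is not a positive integer. For positive integers $a,b,n$ let $$W_{a,b}(n)=\sum_{\substack{l,m\ge 1\\ al+bm=n}}\sigma(l)\,\sigma(m).$$ Let $M_4(N)$ be the finite-dimensional complex vector space of modular forms of weight $4$ on $\Gamma_0(N)$ (trivial character), and let $\lambda_4(N)$ be its dimension. Let $a,b$ be relatively prime positive integers, let $g_1,\dots,g_{\lambda_4(ab)}$ be any basis of $M_4(ab)$, and let $b_i(n)$ denote the $n$-th Fourier coefficient of $g_i$, so that $g_i(z)=\sum_{n\ge 0} b_i(n)e^{2\pi i n z}$. Then there exist constants $\beta_i\in\mathbb{C}$, $1\le i\le\lambda_4(ab)$, not depending on $n$, such that for every positive integer $n$ $$W_{a,b}(n)=\frac1{24}\Bigl(1-\frac{6n}{b}\Bigr)\sigma\Bigl(\frac na\Bigr)+\frac1{24}\Bigl(1-\frac{6n}{a}\Bigr)\sigma\Bigl(\frac nb\Bigr)-\frac1{576}\sum_{i=1}^{\lambda_4(ab)}\beta_i\,b_i(n).$$ -/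

import Mathlib

open scoped MatrixGroups

/-- The divisor function `σ_r(x) = ∑_{d ∣ x} d ^ r` for a positive integer `x`, extended by `0` to
all rational numbers that are not positive integers. -/
def sigmaExt (r : ℕ) (x : ℚ) : ℕ :=
  if 0 < x ∧ x.den = 1 then ArithmeticFunction.sigma r x.num.toNat else 0

/-- The pairs `(l, m)` of positive integers with `a * l + b * m = n`
(for positive `a`, `b`; see `mem_convPairs`). -/
def convPairs (a b n : ℕ) : Finset (ℕ × ℕ) :=
  (Finset.Icc 1 n ×ˢ Finset.Icc 1 n).filter fun p => a * p.1 + b * p.2 = n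

theorem mem_convPairs {a b : ℕ} (ha : 0 < a) (hb : 0 < b) (n : ℕ) (p : ℕ × ℕ) :
    p ∈ convPairs a b n ↔ 0 < p.1 ∧ 0 < p.2 ∧ a * p.1 + b * p.2 = n := by
  simp only [convPairs, Finset.mem_filter, Finset.mem_product, Finset.mem_Icc]
  constructor
  · rintro ⟨⟨⟨h1, _⟩, h2, _⟩, h⟩
    exact ⟨h1, h2, h⟩
  · rintro ⟨h1, h2, h⟩
    have := Nat.le_mul_of_pos_left p.1 ha
    have := Nat.le_mul_of_pos_left p.2 hb
    exact ⟨⟨⟨h1, by omega⟩, h2, by omega⟩, h⟩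

/-- The convolution sum `W_{a,b}^{r,s}(n) = ∑_{l, m ≥ 1, a l + b m = n} σ_r(l) σ_s(m)`. -/
def convSum (r s a b n : ℕ) : ℕ :=
  ∑ p ∈ convPairs a b n, ArithmeticFunction.sigma r p.1 * ArithmeticFunction.sigma s p.2

/-- The space `M_k(N)` of modular forms of weight `k` on `Γ₀(N)` (trivial character). -/
abbrev ModFormSpace (k : ℤ) (N : ℕ) : Type :=
  ModularForm ((CongruenceSubgroup.Gamma0 N).map (Matrix.SpecialLinearGroup.mapGL ℝ)) k

/-- The dimension `λ_k(N)` of `M_k(N)`. -/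
noncomputable def modFormDim (k : ℤ) (N : ℕ) : ℕ :=
  Module.finrank ℂ (ModFormSpace k N)

/-- The `n`-th Fourier coefficient of `f` at infinity, in powers of `q = exp (2 π i z)`. -/
noncomputable def fourierCoeffInf {k : ℤ} {N : ℕ} (f : ModFormSpace k N) (n : ℕ) : ℂ :=
  (UpperHalfPlane.qExpansion 1 f).coeff n

/- Although `E₂` is only quasimodular, adding `-3 / (π Im z)` makes it modular of weight `2`, and
this correction cancels in `a E₂(a z) - b E₂(b z)`, which is therefore a modular form on `Γ₀(N)`
whenever `a` and `b` divide `N`. Likewise `E₄ = E₂² - 12 D E₂`, with `D = q d/dq`, is modular of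
weight `4`. For `A = a E₂(a z)` and `B = b E₂(b z)`, the modular form
`((A - B)² - a² E₄(a z) - b² E₄(b z)) / 2` equals `6 D (A + B) - A B`, and its Fourier coefficients
contain the convolution sum through the product `A B`. Expanding it in the given basis yields the
constants. -/

open Function UpperHalfPlane Derivative EisensteinSeries PowerSeries
open scoped ModularForm Manifold Topology ConjAct Pointwise

section QExpansion

theorem hasSum_natCast_mul_pow_of_hasFPowerSeriesOnBall {𝕜 : Type*} [NontriviallyNormedField 𝕜]
    [CompleteSpace 𝕜] {F : 𝕜 → 𝕜} {c : ℕ → 𝕜} {r : ENNReal}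
    (hF : HasFPowerSeriesOnBall F (.ofScalars 𝕜 c) 0 r) {q : 𝕜} (hq : q ∈ Metric.eball 0 r) :
    HasSum (fun n ↦ (n * c n) * q ^ n) (q * deriv F q) := by
  have hderiv := (hF.fderiv.hasSum hq).mapL (ContinuousLinearMap.apply 𝕜 𝕜 q)
  simp only [ContinuousLinearMap.apply_apply, zero_add,
    FormalMultilinearSeries.derivSeries_apply_diag] at hderiv
  rw [← hasSum_nat_add_iff' 1]
  convert hderiv using 1
  · ext n
    simp only [Nat.cast_add, Nat.cast_one, FormalMultilinearSeries.apply_eq_prod_smul_coeff,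
      Finset.prod_const, Finset.card_univ, Fintype.card_fin,
      FormalMultilinearSeries.coeff_ofScalars, smul_eq_mul, nsmul_eq_mul]
    ring
  · simp [fderiv_eq_smul_deriv]

theorem coeff_X_mul_derivative {R : Type*} [CommSemiring R] (p : R⟦X⟧) (n : ℕ) :
    (X * d⁄dX R p).coeff n = n * p.coeff n := by
  cases n <;> simp [coeff_succ_X_mul, coeff_derivative, mul_comm]

/-- `HasQExpansion f p` says that `f` is holomorphic on the upper half plane and is everywhere the
sum of the power series `p` evaluated at `q = exp (2 π i z)`. -/
structure HasQExpansion (f : ℍ → ℂ) (p : ℂ⟦X⟧) : Prop where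
  mdiff : MDiff f
  hasSum (τ : ℍ) : HasSum (fun n ↦ p.coeff n • Periodic.qParam 1 τ ^ n) (f τ)

namespace HasQExpansion

variable {f g : ℍ → ℂ} {p r : ℂ⟦X⟧}

theorem isBoundedAtImInfty (hf : HasQExpansion f p) : IsBoundedAtImInfty f :=
  isBoundedAtImInfty_of_hasSum_qExpansion one_pos hf.hasSum

theorem periodic (hf : HasQExpansion f p) : Periodic (f ∘ ofComplex) (1 : ℝ) := by
  intro w
  by_cases! hw : 0 < w.im
  · have hw' : 0 < (w + (1 : ℝ)).im := by simpa using hw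
    have hq : Periodic.qParam 1 (w + (1 : ℝ)) = Periodic.qParam 1 w := by
      simp [Periodic.qParam, mul_add, Complex.exp_add]
    simp only [comp_apply, ofComplex_apply_of_im_pos hw', ofComplex_apply_of_im_pos hw]
    exact (hf.hasSum _).unique (by simpa only [hq] using hf.hasSum ⟨w, hw⟩)
  · have hw' : (w + (1 : ℝ)).im ≤ 0 := by simpa using hw
    simp only [comp_apply, ofComplex_apply_of_im_nonpos hw', ofComplex_apply_of_im_nonpos hw]

theorem analyticAt_cuspFunction (hf : HasQExpansion f p) : AnalyticAt ℂ (cuspFunction 1 f) 0 :=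
  analyticAt_cuspFunction_zero one_pos hf.periodic hf.mdiff hf.isBoundedAtImInfty

theorem hasFPowerSeriesOnBall (hf : HasQExpansion f p) :
    HasFPowerSeriesOnBall (cuspFunction 1 f) (.ofScalars ℂ fun n ↦ p.coeff n) 0 1 :=
  hasFPowerSeriesOnBall_cuspFunction one_pos hf.analyticAt_cuspFunction hf.hasSum

theorem qExpansion_eq (hf : HasQExpansion f p) : qExpansion 1 f = p := by
  ext n
  exact (@qExpansion_coeff_unique (ℍ → ℂ) ⟨id, injective_id⟩ 1 f _ one_pos
    hf.analyticAt_cuspFunction hf.hasSum n).symm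

theorem add (hf : HasQExpansion f p) (hg : HasQExpansion g r) : HasQExpansion (f + g) (p + r) where
  mdiff := hf.mdiff.add hg.mdiff
  hasSum τ := by simpa [add_mul] using (hf.hasSum τ).add (hg.hasSum τ)

theorem sub (hf : HasQExpansion f p) (hg : HasQExpansion g r) : HasQExpansion (f - g) (p - r) where
  mdiff := hf.mdiff.sub hg.mdiff
  hasSum τ := by simpa [sub_mul] using (hf.hasSum τ).sub (hg.hasSum τ)

theorem smul (hf : HasQExpansion f p) (c : ℂ) : HasQExpansion (c • f) (c • p) where
  mdiff := hf.mdiff.const_smul c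
  hasSum τ := by simpa [mul_assoc] using (hf.hasSum τ).mul_left c

theorem mul (hf : HasQExpansion f p) (hg : HasQExpansion g r) : HasQExpansion (f * g) (p * r) where
  mdiff := hf.mdiff.mul hg.mdiff
  hasSum τ := by
    have hper : Periodic ((f * g) ∘ ofComplex) (1 : ℝ) := hf.periodic.mul hg.periodic
    have hsum := UpperHalfPlane.hasSum_qExpansion one_pos hper (hf.mdiff.mul hg.mdiff)
      (hf.isBoundedAtImInfty.mul hg.isBoundedAtImInfty) τ
    rwa [qExpansion_mul hf.analyticAt_cuspFunction hg.analyticAt_cuspFunction, hf.qExpansion_eq,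
      hg.qExpansion_eq] at hsum

theorem normalizedDeriv_apply (hf : HasQExpansion f p) (τ : ℍ) :
    D f τ = Periodic.qParam 1 τ * deriv (cuspFunction 1 f) (Periodic.qParam 1 τ) := by
  set q := Periodic.qParam 1 τ
  have hq : HasDerivAt (Periodic.qParam 1) (q * (2 * Real.pi * Complex.I)) (τ : ℂ) := by
    have hexp : Periodic.qParam 1 = fun w ↦ Complex.exp (2 * Real.pi * Complex.I * id w) := by
      ext w
      simp [Periodic.qParam]
    simpa only [q, hexp, mul_one] using!
      ((hasDerivAt_id (τ : ℂ)).const_mul (2 * Real.pi * Complex.I)).cexp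
  have hF : HasDerivAt (cuspFunction 1 f) (deriv (cuspFunction 1 f) q) q :=
    (differentiableAt_cuspFunction one_pos hf.periodic hf.mdiff hf.isBoundedAtImInfty
      (Periodic.norm_qParam_lt_one one_pos τ.im_pos)).hasDerivAt
  have hcomp : f ∘ ofComplex =ᶠ[𝓝 (τ : ℂ)] cuspFunction 1 f ∘ Periodic.qParam 1 := by
    filter_upwards [isOpen_upperHalfPlaneSet.mem_nhds τ.im_pos] with w hw
    simpa only [comp_apply, ofComplex_apply_of_im_pos hw] using
      (eq_cuspFunction (f := f) ⟨w, hw⟩ one_ne_zero hf.periodic).symm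
  rw [normalizedDerivOfComplex, ((hF.comp (τ : ℂ) hq).congr_of_eventuallyEq hcomp).deriv]
  have := Complex.two_pi_I_ne_zero
  field

theorem normalizedDeriv (hf : HasQExpansion f p) : HasQExpansion (D f) (X * d⁄dX ℂ p) where
  mdiff := normalizedDerivOfComplex_mdifferentiable hf.mdiff
  hasSum τ := by
    have hq : Periodic.qParam 1 τ ∈ Metric.eball (0 : ℂ) 1 := by
      rw [← ENNReal.coe_one, Metric.eball_coe]
      simpa using Periodic.norm_qParam_lt_one one_pos τ.im_pos
    simpa only [hf.normalizedDeriv_apply, coeff_X_mul_derivative, smul_eq_mul] using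
      hasSum_natCast_mul_pow_of_hasFPowerSeriesOnBall hf.hasFPowerSeriesOnBall hq

end HasQExpansion

end QExpansion

section DiagGL

variable (a : ℕ) [NeZero a]

/-- The matrix `diag(a, 1)`, whose weight `k` slash operator is
`f ↦ a ^ (k - 1) f(a z)`. -/
noncomputable def diagGL : GL (Fin 2) ℝ :=
  Matrix.GeneralLinearGroup.mkOfDetNeZero !![(a : ℝ), 0; 0, 1] (by simp [NeZero.ne a])

theorem coe_diagGL : (diagGL a : Matrix (Fin 2) (Fin 2) ℝ) = !![(a : ℝ), 0; 0, 1] := rfl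

theorem det_diagGL : (diagGL a).det.val = a := by
  simp [coe_diagGL]

theorem det_diagGL_pos : 0 < (diagGL a).det.val := by
  rw [det_diagGL]
  exact_mod_cast NeZero.pos a

theorem denom_diagGL (z : ℂ) : denom (diagGL a) z = 1 := by
  simp [denom, coe_diagGL]

theorem coe_diagGL_smul (τ : ℍ) : ((diagGL a • τ : ℍ) : ℂ) = a * τ := by
  rw [coe_smul_of_det_pos (det_diagGL_pos a), denom_diagGL]
  simp [num, coe_diagGL]

theorem slash_diagGL_apply (k : ℤ) (f : ℍ → ℂ) (τ : ℍ) :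
    (f ∣[k] diagGL a) τ = (a : ℂ) ^ (k - 1) * f (diagGL a • τ) := by
  have hσ (x : ℂ) : σ (diagGL a) x = x := by
    rw [σ, if_pos (det_diagGL_pos a)]
    rfl
  rw [ModularForm.slash_apply, hσ, det_diagGL, denom_diagGL]
  simp [mul_comm]

variable {a}

theorem HasQExpansion.slash_diagGL {f : ℍ → ℂ} {p : ℂ⟦X⟧} (hf : HasQExpansion f p) (k : ℤ) :
    HasQExpansion (f ∣[k] diagGL a) ((a : ℂ) ^ (k - 1) • p.expand a (NeZero.ne a)) where
  mdiff := hf.mdiff.slash k _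
  hasSum τ := by
    have hq : Periodic.qParam 1 (diagGL a • τ : ℍ) = Periodic.qParam 1 τ ^ a := by
      rw [coe_diagGL_smul, Periodic.qParam, Periodic.qParam, ← Complex.exp_nat_mul]
      congr 1
      ring
    have hexpand : HasSum (fun n ↦ (p.expand a (NeZero.ne a)).coeff n • Periodic.qParam 1 τ ^ n)
        (f (diagGL a • τ)) := by
      have hinj : Injective (a * ·) := mul_right_injective₀ (NeZero.ne a)
      refine (hinj.hasSum_iff fun n hn ↦ ?_).mp ?_
      · rw [coeff_expand_of_not_dvd _ _ _ fun ⟨m, hm⟩ ↦ hn ⟨m, hm.symm⟩, zero_smul]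
      · simpa [comp_def, hq, ← pow_mul] using hf.hasSum (diagGL a • τ)
    simpa [slash_diagGL_apply, mul_assoc] using hexpand.mul_left ((a : ℂ) ^ (k - 1))

theorem toConjAct_diagGL_smul_Gamma0_le {N : ℕ} (haN : a ∣ N) :
    ConjAct.toConjAct (diagGL a) •
      (CongruenceSubgroup.Gamma0 N).map (Matrix.SpecialLinearGroup.mapGL ℝ) ≤ 𝒮ℒ := by
  rintro _ ⟨_, ⟨γ, hγ, rfl⟩, rfl⟩
  obtain ⟨c, hc⟩ : (a : ℤ) ∣ γ 1 0 := by
    have hN := (ZMod.intCast_zmod_eq_zero_iff_dvd _ _).mp (CongruenceSubgroup.Gamma0_mem.mp hγ)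
    exact (Int.natCast_dvd_natCast.mpr haN).trans hN
  obtain ⟨δ, hδ⟩ : ∃ δ : SL(2, ℤ), (δ : Matrix (Fin 2) (Fin 2) ℤ) =
      !![γ 0 0, a * γ 0 1; c, γ 1 1] := by
    refine ⟨⟨_, ?_⟩, rfl⟩
    have hdet := γ.det_coe
    rw [Matrix.det_fin_two, hc] at hdet
    rw [Matrix.det_fin_two_of]
    linear_combination hdet
  have hc' : ((γ 1 0 : ℤ) : ℝ) = a * c := by exact_mod_cast hc
  refine ⟨δ, ?_⟩
  simp only [MulDistribMulAction.toMonoidEnd_apply, MulDistribMulAction.toMonoidHom_apply,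
    ConjAct.toConjAct_smul]
  rw [_root_.eq_mul_inv_iff_mul_eq]
  ext i j
  fin_cases i <;> fin_cases j <;>
    simp [coe_diagGL, Matrix.mul_apply, Fin.sum_univ_two, hδ, hc', mul_comm]

end DiagGL

/-- The conditions defining a modular form of weight `k` for `Γ`, except for holomorphy. They hold
for the nonholomorphic Eisenstein series `E2Star`. -/
structure IsSlashInvariantBounded (Γ : Subgroup (GL (Fin 2) ℝ)) (k : ℤ) (F : ℍ → ℂ) : Prop where
  slash_eq {γ : GL (Fin 2) ℝ} (hγ : γ ∈ Γ) : F ∣[k] γ = F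
  isBoundedAt {c : OnePoint ℝ} (hc : IsCusp c Γ) : c.IsBoundedAt F k

namespace IsSlashInvariantBounded

variable {Γ Γ' : Subgroup (GL (Fin 2) ℝ)} {k : ℤ} {F G : ℍ → ℂ}

theorem of_SL2Z (hF : ∀ γ : SL(2, ℤ), F ∣[k] γ = F) (hb : IsBoundedAtImInfty F) :
    IsSlashInvariantBounded 𝒮ℒ k F where
  slash_eq := by
    rintro _ ⟨γ, rfl⟩
    exact hF γ
  isBoundedAt hc := (OnePoint.isBoundedAt_iff_forall_SL2Z hc).mpr fun γ _ ↦ by rwa [hF γ]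

theorem sub (hF : IsSlashInvariantBounded Γ k F) (hG : IsSlashInvariantBounded Γ k G) :
    IsSlashInvariantBounded Γ k (F - G) where
  slash_eq hγ := by
    rw [sub_eq_add_neg, SlashAction.add_slash, SlashAction.neg_slash, hF.slash_eq hγ,
      hG.slash_eq hγ]
  isBoundedAt hc γ hγ := by
    rw [sub_eq_add_neg, SlashAction.add_slash, SlashAction.neg_slash]
    exact (hF.isBoundedAt hc γ hγ).add (hG.isBoundedAt hc γ hγ).neg

theorem slash (hF : IsSlashInvariantBounded Γ' k F) {A : GL (Fin 2) ℝ}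
    (hA : ConjAct.toConjAct A • Γ ≤ Γ') : IsSlashInvariantBounded Γ k (F ∣[k] A) where
  slash_eq {γ} hγ := by
    have hconj : A * γ * A⁻¹ ∈ Γ' := by
      rw [← ConjAct.toConjAct_smul]
      exact hA (Γ.smul_mem_pointwise_smul _ _ hγ)
    rw [← SlashAction.slash_mul, ← inv_mul_cancel_right (A * γ) A, SlashAction.slash_mul,
      hF.slash_eq hconj]
  isBoundedAt hc := OnePoint.IsBoundedAt.smul_iff.mp (hF.isBoundedAt ((hc.smul A).mono hA))

/-- The modular form given by a holomorphic function. -/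
def toModularForm (hF : IsSlashInvariantBounded Γ k F) (hd : MDiff F) : ModularForm Γ k where
  toFun := F
  slash_action_eq' _ hγ := hF.slash_eq hγ
  holo' := hd
  bdd_at_cusps' hc := hF.isBoundedAt hc

end IsSlashInvariantBounded

section Eisenstein

theorem E2_slash (γ : SL(2, ℤ)) : E2 ∣[(2 : ℤ)] γ = E2 - (3 / Real.pi ^ 2 : ℂ) • D2 γ := by
  rw [E2_slash_action, riemannZeta_two]
  congr 2
  field_simp
  norm_num

theorem inv_im_slash (γ : SL(2, ℤ)) :
    (fun z : ℍ ↦ (z.im : ℂ)⁻¹) ∣[(2 : ℤ)] γ =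
      (fun z : ℍ ↦ (z.im : ℂ)⁻¹) - (Real.pi : ℂ)⁻¹ • D2 γ := by
  ext z
  have hpi := Complex.ofReal_ne_zero.mpr Real.pi_ne_zero
  have hd := denom_ne_zero γ z
  have hy : (z.im : ℂ) ≠ 0 := Complex.ofReal_ne_zero.mpr z.im_ne_zero
  have him : ((γ • z).im : ℂ) = z.im / (denom γ z * starRingEnd ℂ (denom γ z)) := by
    rw [ModularGroup.im_smul_eq_div_normSq, Complex.mul_conj, Complex.ofReal_div]
  have hconj : starRingEnd ℂ (denom γ z) = denom γ z - 2 * Complex.I * γ 1 0 * z.im := by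
    have him_denom : (denom γ z).im = γ 1 0 * z.im := by simp [ModularGroup.denom_apply]
    have hsub := Complex.sub_conj (denom γ z)
    rw [him_denom] at hsub
    push_cast at hsub
    linear_combination -hsub
  simp only [ModularForm.SL_slash_apply, Pi.sub_apply, Pi.smul_apply, smul_eq_mul, D2, him,
    zpow_neg, inv_div]
  rw [hconj, zpow_ofNat]
  field_simp

/-- The nonholomorphic Eisenstein series `E₂(z) - 3 / (π Im z)` of weight `2`. -/
noncomputable def E2Star : ℍ → ℂ := E2 - (3 / Real.pi : ℂ) • fun z ↦ (z.im : ℂ)⁻¹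

theorem E2Star_slash (γ : SL(2, ℤ)) : E2Star ∣[(2 : ℤ)] γ = E2Star := by
  rw [E2Star, sub_eq_add_neg, SlashAction.add_slash, SlashAction.neg_slash,
    ModularForm.SL_smul_slash, E2_slash, inv_im_slash, smul_sub, smul_smul]
  have hpi := Complex.ofReal_ne_zero.mpr Real.pi_ne_zero
  rw [show (3 / Real.pi : ℂ) * (Real.pi : ℂ)⁻¹ = 3 / Real.pi ^ 2 by field]
  abel

theorem isBoundedAtImInfty_inv_im : IsBoundedAtImInfty fun z : ℍ ↦ (z.im : ℂ)⁻¹ := by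
  refine isBoundedAtImInfty_iff.mpr ⟨1, 1, fun z hz ↦ ?_⟩
  rw [norm_inv, Complex.norm_real, Real.norm_of_nonneg z.im_pos.le]
  exact inv_le_one_of_one_le₀ hz

theorem isSlashInvariantBounded_E2Star : IsSlashInvariantBounded 𝒮ℒ 2 E2Star :=
  .of_SL2Z E2Star_slash (isBoundedAtImInfty_E2.sub (isBoundedAtImInfty_inv_im.smul _))

theorem mdifferentiable_D2 (γ : SL(2, ℤ)) : MDiff (D2 γ) := by
  have hD2 : D2 γ = (Real.pi ^ 2 / 3 : ℂ) • (E2 - E2 ∣[(2 : ℤ)] γ) := by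
    have hpi := Complex.ofReal_ne_zero.mpr Real.pi_ne_zero
    rw [E2_slash, sub_sub_cancel, smul_smul]
    simp [hpi]
  rw [hD2]
  exact (E2_mdifferentiable.sub (E2_mdifferentiable.slash 2 _)).const_smul _

theorem normalizedDeriv_D2 (γ : SL(2, ℤ)) :
    D (D2 γ) = (1 / (4 * Real.pi ^ 2) : ℂ) • (D2 γ * D2 γ) := by
  ext z
  have hpi := Complex.ofReal_ne_zero.mpr Real.pi_ne_zero
  have hd := denom_ne_zero γ z
  have hcomp : D2 γ ∘ ofComplex =ᶠ[𝓝 (z : ℂ)]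
      fun w ↦ 2 * Real.pi * Complex.I * γ 1 0 * denom γ w ^ (-1 : ℤ) := by
    filter_upwards [isOpen_upperHalfPlaneSet.mem_nhds z.im_pos] with w hw
    simp [D2, ofComplex_apply_of_im_pos hw, div_eq_mul_inv]
  have hentry : (((γ : GL (Fin 2) ℝ) 1 0 : ℝ) : ℂ) = γ 1 0 := by simp
  rw [normalizedDerivOfComplex,
    (((hasDerivAt_denom_zpow γ (-1) z).const_mul _).congr_of_eventuallyEq hcomp).deriv, hentry]
  simp only [Pi.smul_apply, Pi.mul_apply, smul_eq_mul, D2, Int.reduceNeg, Int.reduceSub, zpow_neg,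
    zpow_ofNat, Int.cast_neg, Int.cast_one]
  field_simp
  rw [Complex.I_sq]
  ring

/-- The combination `E₂² - 12 D E₂`, which is modular of weight `4` and level one; by Ramanujan's
identity it is `E₄`. -/
noncomputable def ramanujanE4 : ℍ → ℂ := E2 * E2 - (12 : ℂ) • D E2

theorem serreDerivative_E2_slash (γ : SL(2, ℤ)) :
    serreDerivative 2 E2 ∣[(4 : ℤ)] γ =
      serreDerivative 2 E2 - (3 / Real.pi ^ 2 : ℂ) • serreDerivative 2 (D2 γ) := by
  rw [← serreDerivative_smul _ _ _ (mdifferentiable_D2 γ), ← serreDerivative_sub _ _ _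
    E2_mdifferentiable ((mdifferentiable_D2 γ).const_smul _), ← E2_slash]
  exact_mod_cast serreDerivative_slash_equivariant (k := 2) E2_mdifferentiable

theorem ramanujanE4_slash (γ : SL(2, ℤ)) : ramanujanE4 ∣[(4 : ℤ)] γ = ramanujanE4 := by
  have hsq : (E2 * E2) ∣[(4 : ℤ)] γ = (E2 ∣[(2 : ℤ)] γ) * (E2 ∣[(2 : ℤ)] γ) :=
    ModularForm.mul_slash_SL2 2 2 γ E2 E2
  have hserre : ramanujanE4 = -(E2 * E2) + (-12 : ℂ) • serreDerivative 2 E2 := by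
    ext z
    simp only [ramanujanE4, serreDerivative_apply, Pi.sub_apply, Pi.add_apply, Pi.neg_apply,
      Pi.mul_apply, Pi.smul_apply, smul_eq_mul]
    ring
  rw [hserre, SlashAction.add_slash, SlashAction.neg_slash, ModularForm.SL_smul_slash, hsq,
    serreDerivative_E2_slash, E2_slash]
  ext z
  simp only [Pi.add_apply, Pi.sub_apply, Pi.neg_apply, Pi.mul_apply, Pi.smul_apply, smul_eq_mul,
    serreDerivative_apply, normalizedDeriv_D2]
  ring

end Eisenstein

section SigmaSeries

/-- The generating series `∑ σ_r(n) X ^ n`; its constant coefficient is `σ_r(0) = 0`. -/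
noncomputable def sigmaSeries (R : Type*) [Semiring R] (r : ℕ) : R⟦X⟧ :=
  .mk fun n ↦ (ArithmeticFunction.sigma r n : R)

variable {R : Type*} [CommRing R]

theorem sigmaExt_natCast (r n : ℕ) : sigmaExt r n = ArithmeticFunction.sigma r n := by
  rcases n.eq_zero_or_pos with rfl | hn <;> simp [sigmaExt, *]

theorem coeff_expand_sigmaSeries (r : ℕ) {a : ℕ} (ha : a ≠ 0) (n : ℕ) :
    ((sigmaSeries R r).expand a ha).coeff n = (sigmaExt r ((n : ℚ) / a) : R) := by
  have ha' : (a : ℚ) ≠ 0 := Nat.cast_ne_zero.mpr ha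
  by_cases h : a ∣ n
  · obtain ⟨m, rfl⟩ := h
    rw [coeff_expand_mul, Nat.cast_mul, mul_div_cancel_left₀ _ ha', sigmaExt_natCast, sigmaSeries,
      coeff_mk]
  · rw [coeff_expand_of_not_dvd _ _ _ h, sigmaExt, if_neg, Nat.cast_zero]
    rintro ⟨-, hden⟩
    obtain ⟨m, hm⟩ : ∃ m : ℤ, (n : ℚ) / a = m := ⟨_, ((Rat.den_eq_one_iff _).mp hden).symm⟩
    rw [div_eq_iff ha', mul_comm] at hm
    exact h (Int.natCast_dvd_natCast.mp ⟨m, by exact_mod_cast hm⟩)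

theorem coeff_expand_sigmaSeries_mul_expand_sigmaSeries (r s : ℕ) {a b : ℕ} (ha : a ≠ 0)
    (hb : b ≠ 0) (n : ℕ) :
    ((sigmaSeries R r).expand a ha * (sigmaSeries R s).expand b hb).coeff n =
      (convSum r s a b n : R) := by
  have hpairs := mem_convPairs (Nat.pos_of_ne_zero ha) (Nat.pos_of_ne_zero hb) n
  rw [coeff_mul, convSum, Nat.cast_sum]
  symm
  refine Finset.sum_of_injOn (fun p ↦ (a * p.1, b * p.2)) ?_ ?_ ?_ ?_
  · exact ((mul_right_injective₀ ha).prodMap (mul_right_injective₀ hb)).injOn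
  · exact fun p hp ↦ by simpa using ((hpairs p).mp hp).2.2
  · rintro ⟨i, j⟩ hij hne
    by_cases hi : a ∣ i
    · by_cases hj : b ∣ j
      · obtain ⟨l, rfl⟩ := hi
        obtain ⟨m, rfl⟩ := hj
        have : l = 0 ∨ m = 0 := by
          by_contra! hlm
          exact hne ⟨(l, m), (hpairs _).mpr ⟨Nat.pos_of_ne_zero hlm.1, Nat.pos_of_ne_zero hlm.2,
            Finset.HasAntidiagonal.mem_antidiagonal.mp hij⟩, rfl⟩
        rcases this with rfl | rfl <;> simp [sigmaSeries, coeff_expand]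
      · rw [coeff_expand_of_not_dvd _ _ _ hj, mul_zero]
    · rw [coeff_expand_of_not_dvd _ _ _ hi, zero_mul]
  · exact fun p _ ↦ by simp [sigmaSeries]

end SigmaSeries

/-- The expansion of `E₂` in powers of `q`. -/
noncomputable def E2Series : ℂ⟦X⟧ := 1 - (24 : ℂ) • sigmaSeries ℂ 1

theorem hasQExpansion_E2 : HasQExpansion E2 E2Series where
  mdiff := E2_mdifferentiable
  hasSum τ := by
    convert hasSum_qExpansion_E2 (z := τ) using 3 with n
    · by_cases hn : n = 0 <;> simp [E2Series, sigmaSeries, coeff_one, hn]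
    · simp [Periodic.qParam]

theorem hasQExpansion_ramanujanE4 :
    HasQExpansion ramanujanE4 (E2Series * E2Series - (12 : ℂ) • (X * d⁄dX ℂ E2Series)) :=
  (hasQExpansion_E2.mul hasQExpansion_E2).sub (hasQExpansion_E2.normalizedDeriv.smul 12)

theorem isSlashInvariantBounded_ramanujanE4 : IsSlashInvariantBounded 𝒮ℒ 4 ramanujanE4 :=
  .of_SL2Z ramanujanE4_slash hasQExpansion_ramanujanE4.isBoundedAtImInfty

section Level

variable {a b N : ℕ} [NeZero a] [NeZero b]

theorem E2Star_slash_diagGL :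
    E2Star ∣[(2 : ℤ)] diagGL a =
      E2 ∣[(2 : ℤ)] diagGL a - (3 / Real.pi : ℂ) • fun z : ℍ ↦ (z.im : ℂ)⁻¹ := by
  ext z
  have him : (diagGL a • z).im = a * z.im := by
    rw [← coe_im, coe_diagGL_smul]
    simp
  have ha : (a : ℂ) ≠ 0 := NeZero.ne _
  simp only [slash_diagGL_apply, E2Star, Pi.sub_apply, Pi.smul_apply, smul_eq_mul, him,
    Complex.ofReal_mul, Complex.ofReal_natCast, Int.reduceSub, zpow_one]
  field

theorem isSlashInvariantBounded_E2_slash_diagGL_sub (haN : a ∣ N) (hbN : b ∣ N) :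
    IsSlashInvariantBounded
      ((CongruenceSubgroup.Gamma0 N).map (Matrix.SpecialLinearGroup.mapGL ℝ)) 2
      (E2 ∣[(2 : ℤ)] diagGL a - E2 ∣[(2 : ℤ)] diagGL b) := by
  have hstar := (isSlashInvariantBounded_E2Star.slash (toConjAct_diagGL_smul_Gamma0_le haN)).sub
    (isSlashInvariantBounded_E2Star.slash (toConjAct_diagGL_smul_Gamma0_le hbN))
  rwa [E2Star_slash_diagGL, E2Star_slash_diagGL, sub_sub_sub_cancel_right] at hstar

theorem normalizedDeriv_slash_diagGL {f : ℍ → ℂ} (hf : MDiff f) (k : ℤ) :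
    D f ∣[k + 2] diagGL a = (a : ℂ) • D (f ∣[k] diagGL a) := by
  have hdet : (diagGL a).val.det = a := det_diagGL a
  ext z
  have ha : (a : ℂ) ≠ 0 := NeZero.ne _
  rw [normalizedDerivOfComplex_slash hf (det_diagGL_pos a), hdet]
  simp [coe_diagGL, ha]

theorem ramanujanE4_slash_diagGL :
    ramanujanE4 ∣[(4 : ℤ)] diagGL a =
      (a : ℂ) • ((E2 ∣[(2 : ℤ)] diagGL a) * (E2 ∣[(2 : ℤ)] diagGL a) -
        (12 : ℂ) • D (E2 ∣[(2 : ℤ)] diagGL a)) := by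
  have hsq : (E2 * E2) ∣[(4 : ℤ)] diagGL a =
      (a : ℂ) • ((E2 ∣[(2 : ℤ)] diagGL a) * (E2 ∣[(2 : ℤ)] diagGL a)) := by
    have hmul := ModularForm.mul_slash 2 2 (diagGL a) E2 E2
    rw [det_diagGL, Nat.abs_cast] at hmul
    exact_mod_cast hmul
  have hD : D E2 ∣[(4 : ℤ)] diagGL a = (a : ℂ) • D (E2 ∣[(2 : ℤ)] diagGL a) :=
    normalizedDeriv_slash_diagGL E2_mdifferentiable 2
  have hσ : σ (diagGL a) 12 = 12 := map_ofNat _ 12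
  rw [ramanujanE4, sub_eq_add_neg, SlashAction.add_slash, SlashAction.neg_slash,
    ModularForm.smul_slash, hσ, hsq, hD, smul_sub, smul_comm (12 : ℂ), sub_eq_add_neg]

/-- The modular form `a E₂(a z) - b E₂(b z)` of weight `2` on `Γ₀(N)`, for `a, b ∣ N`. -/
noncomputable def e2Difference (haN : a ∣ N) (hbN : b ∣ N) : ModFormSpace 2 N :=
  (isSlashInvariantBounded_E2_slash_diagGL_sub haN hbN).toModularForm
    ((E2_mdifferentiable.slash 2 _).sub (E2_mdifferentiable.slash 2 _))

/-- The modular form `a³ E₄(a z)` of weight `4` on `Γ₀(N)`, for `a ∣ N`. -/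
noncomputable def ramanujanE4Scaled (haN : a ∣ N) : ModFormSpace 4 N :=
  (isSlashInvariantBounded_ramanujanE4.slash
    (toConjAct_diagGL_smul_Gamma0_le haN)).toModularForm (hasQExpansion_ramanujanE4.mdiff.slash 4 _)

/-- The modular form `((a E₂(a z) - b E₂(b z))² - a² E₄(a z) - b² E₄(b z)) / 2` of weight `4` on
`Γ₀(N)`, for `a, b ∣ N`. -/
noncomputable def convolutionForm (haN : a ∣ N) (hbN : b ∣ N) : ModFormSpace 4 N :=
  (1 / 2 : ℂ) • (ModularForm.mcast (by norm_num) ((e2Difference haN hbN).mul (e2Difference haN hbN))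
    - (a : ℂ)⁻¹ • ramanujanE4Scaled haN - (b : ℂ)⁻¹ • ramanujanE4Scaled hbN)

theorem coe_convolutionForm (haN : a ∣ N) (hbN : b ∣ N) :
    (convolutionForm haN hbN : ℍ → ℂ) =
      (6 : ℂ) • D (E2 ∣[(2 : ℤ)] diagGL a + E2 ∣[(2 : ℤ)] diagGL b) -
        (E2 ∣[(2 : ℤ)] diagGL a) * (E2 ∣[(2 : ℤ)] diagGL b) := by
  have ha : (a : ℂ) ≠ 0 := NeZero.ne _
  have hb : (b : ℂ) ≠ 0 := NeZero.ne _
  have hcoe : (convolutionForm haN hbN : ℍ → ℂ) = (1 / 2 : ℂ) •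
      ((E2 ∣[(2 : ℤ)] diagGL a - E2 ∣[(2 : ℤ)] diagGL b) *
        (E2 ∣[(2 : ℤ)] diagGL a - E2 ∣[(2 : ℤ)] diagGL b)
      - (a : ℂ)⁻¹ • (ramanujanE4 ∣[(4 : ℤ)] diagGL a)
      - (b : ℂ)⁻¹ • (ramanujanE4 ∣[(4 : ℤ)] diagGL b)) := rfl
  rw [hcoe, ramanujanE4_slash_diagGL, ramanujanE4_slash_diagGL, inv_smul_smul₀ ha,
    inv_smul_smul₀ hb, normalizedDerivOfComplex_add _ _ (E2_mdifferentiable.slash 2 _)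
    (E2_mdifferentiable.slash 2 _)]
  ext z
  simp only [Pi.add_apply, Pi.sub_apply, Pi.mul_apply, Pi.smul_apply, smul_eq_mul]
  ring

end Level

section FourierCoeff

variable {k : ℤ} {N : ℕ}

theorem fourierCoeffInf_eq {f : ModFormSpace k N} {p : ℂ⟦X⟧} (hf : HasQExpansion f p) (n : ℕ) :
    fourierCoeffInf f n = p.coeff n :=
  congrArg (coeff n) hf.qExpansion_eq

/-- The `n`-th Fourier coefficient at infinity as a linear functional on `M_k(N)`. -/
noncomputable def fourierCoeffInfₗ (k : ℤ) (N n : ℕ) : ModFormSpace k N →ₗ[ℂ] ℂ where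
  toFun f := fourierCoeffInf f n
  map_add' f g := by
    simp only [fourierCoeffInf, FunLike.coe_add,
      ModularForm.qExpansion_add one_pos (by simp : (1 : ℝ) ∈ _) f g, map_add]
  map_smul' r f := by
    simp only [fourierCoeffInf, FunLike.coe_smul,
      ModularForm.qExpansion_smul one_pos (by simp : (1 : ℝ) ∈ _) r f, map_smul, RingHom.id_apply]

theorem fourierCoeffInf_eq_sum_repr {ι : Type*} [Fintype ι]
    (g : Module.Basis ι ℂ (ModFormSpace k N)) (f : ModFormSpace k N) (n : ℕ) :
    fourierCoeffInf f n = ∑ i, g.repr f i * fourierCoeffInf (g i) n := by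
  have hsum := congrArg (fourierCoeffInfₗ k N n) (g.sum_repr f)
  simp only [map_sum, map_smul, smul_eq_mul] at hsum
  exact hsum.symm

end FourierCoeff

theorem hasQExpansion_E2_slash_diagGL (a : ℕ) [NeZero a] :
    HasQExpansion (E2 ∣[(2 : ℤ)] diagGL a)
      ((a : ℂ) • (1 - (24 : ℂ) • (sigmaSeries ℂ 1).expand a (NeZero.ne a))) := by
  simpa [E2Series] using hasQExpansion_E2.slash_diagGL (a := a) 2

theorem fourierCoeffInf_convolutionForm {a b N : ℕ} [NeZero a] [NeZero b] (haN : a ∣ N)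
    (hbN : b ∣ N) {n : ℕ} (hn : n ≠ 0) :
    fourierCoeffInf (convolutionForm haN hbN) n =
      24 * a * b * (sigmaExt 1 ((n : ℚ) / a) + sigmaExt 1 ((n : ℚ) / b))
        - 144 * n * (a * sigmaExt 1 ((n : ℚ) / a) + b * sigmaExt 1 ((n : ℚ) / b))
        - 576 * a * b * convSum 1 1 a b n := by
  have hA := hasQExpansion_E2_slash_diagGL a
  have hB := hasQExpansion_E2_slash_diagGL b
  have hΦ := ((hA.add hB).normalizedDeriv.smul 6).sub (hA.mul hB)
  rw [← coe_convolutionForm haN hbN] at hΦ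
  rw [fourierCoeffInf_eq hΦ]
  set S := (sigmaSeries ℂ 1).expand a (NeZero.ne a) with hS
  set T := (sigmaSeries ℂ 1).expand b (NeZero.ne b) with hT
  have hmul : ((a : ℂ) • (1 - (24 : ℂ) • S)) * ((b : ℂ) • (1 - (24 : ℂ) • T)) =
      (a * b : ℂ) • (1 - (24 : ℂ) • (S + T) + (576 : ℂ) • (S * T)) := by
    simp only [smul_eq_C_mul, map_mul]
    rw [show (C (576 : ℂ)) = C 24 * C 24 by rw [← map_mul]; norm_num]
    ring
  rw [hmul, map_sub, coeff_smul, coeff_X_mul_derivative]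
  simp only [map_sub, map_add, coeff_smul, coeff_one, if_neg hn, hS, hT,
    coeff_expand_sigmaSeries, coeff_expand_sigmaSeries_mul_expand_sigmaSeries, smul_eq_mul]
  ring

theorem corollary2p4_general {a b N : ℕ} (ha : 0 < a) (hb : 0 < b) (haN : a ∣ N) (hbN : b ∣ N)
    {ι : Type*} [Fintype ι] (g : Module.Basis ι ℂ (ModFormSpace 4 N)) :
    ∃ β : ι → ℂ, ∀ n : ℕ, 0 < n →
      (convSum 1 1 a b n : ℂ) =
        (1 / 24 : ℂ) * (1 - 6 * (n : ℂ) / (b : ℂ)) * (sigmaExt 1 ((n : ℚ) / (a : ℚ)) : ℂ)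
        + (1 / 24 : ℂ) * (1 - 6 * (n : ℂ) / (a : ℂ)) * (sigmaExt 1 ((n : ℚ) / (b : ℚ)) : ℂ)
        - (1 / 576 : ℂ) * ∑ i, β i * fourierCoeffInf (g i) n := by
  have : NeZero a := ⟨ha.ne'⟩
  have : NeZero b := ⟨hb.ne'⟩
  have ha' : (a : ℂ) ≠ 0 := NeZero.ne _
  have hb' : (b : ℂ) ≠ 0 := NeZero.ne _
  let Φ := convolutionForm haN hbN
  refine ⟨fun i ↦ g.repr Φ i / (a * b), fun n hn ↦ ?_⟩
  have hsum : ∑ i, g.repr Φ i / (a * b) * fourierCoeffInf (g i) n =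
      fourierCoeffInf Φ n / (a * b) := by
    rw [fourierCoeffInf_eq_sum_repr g, Finset.sum_div]
    exact Finset.sum_congr rfl fun i _ ↦ by ring
  rw [hsum, fourierCoeffInf_convolutionForm haN hbN hn.ne']
  field

theorem corollary2p4 (a b : ℕ) (ha : 0 < a) (hb : 0 < b) (hab : Nat.Coprime a b)
    (g : Module.Basis (Fin (modFormDim 4 (a * b))) ℂ (ModFormSpace 4 (a * b))) :
    ∃ β : Fin (modFormDim 4 (a * b)) → ℂ, ∀ n : ℕ, 0 < n →
      (convSum 1 1 a b n : ℂ) =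
        (1 / 24 : ℂ) * (1 - 6 * (n : ℂ) / (b : ℂ)) * (sigmaExt 1 ((n : ℚ) / (a : ℚ)) : ℂ)
        + (1 / 24 : ℂ) * (1 - 6 * (n : ℂ) / (a : ℂ)) * (sigmaExt 1 ((n : ℚ) / (b : ℚ)) : ℂ)
        - (1 / 576 : ℂ) * ∑ i, β i * fourierCoeffInf (g i) n :=
  corollary2p4_general ha hb (Dvd.intro b rfl) (Dvd.intro_left a rfl) g
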